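/- Conventions. All sequences are binary, i.e. over $\mathbb{F}_2=\mathbb{Z}/2\mathbb{Z}$. For integers $a,b$ (possibly negative) let $\binom ab=0$ if $b<0$ and $\binom ab=\frac{a(a-1)\cdots(a-b+1)}{b!}$ if $b\ge 0$. A Steinhaus triangle of size $N$ is a family $(a_{i,j})_{1\le i\le j\le N}$ in $\mathbb{F}_2$ with $a_{i,j}=a_{i-1,j-1}+a_{i-1,j}$ for $2\le i\le j\le N$; $\nabla S$ denotes the one with first row $S$. On Steinhaus triangles of size $N$ let $r\colon(a_{i,j})\mapsto(a_{j-i+1,N-i+1})$, $h\colon(a_{i,j})\mapsto(a_{i,N-j+i})$ and $\rho=r^2+r+\mathrm{id}$. Let $\mathcal{DST}_0(N)$ be the space of Steinhaus triangles of size $N$ that are fixed by $r$ and $h$ and whose first row contains an even number of ones. A Steinhaus graph of order $n\ge 1$ is a simple graph on the vertices $1,\dots,n$ whose adjacency matrix $(m_{i,j})$ has as upper-triangular part a Steinhaus triangle of size $n-1$ (with entries $a_{i,j}=m_{i,j+1}$, $1\le i\le j\le n-1$); $G_S$ denotes the one whose triangle is $\nabla S$, for $S$ of length $n-1$. Graphs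 on $\{1,\dots,n\}$ form an $\mathbb{F}_2$-vector space under addition of adjacency matrices modulo $2$. A graph is even (odd) if all its vertex degrees are even (odd). Let $ESG(n)$ and $OSG(n)$ be the sets of even and of odd Steinhaus graphs of order $n$, and $PRSG(n)=ESG(n)\cup OSG(n)$; $ESG(n)$ and $PRSG(n)$ are linear subspaces. For a Steinhaus triangle of size $2n-1$ let $\psi\big((a_{i,j})\big)=G_{(a_{2,2j})_{1\le j\le n-1}}$. Theorem. Let $n$ be a positive integer. For $0\le k\le\lfloor\frac{n-1}{3}\rfloor-1$ put $$T_k=\rho\Big(\nabla\Big(\tbinom{k-n+j}{2k+1}\bmod 2\Big)_{1\le j\le 2n-1}\Big).$$ Then $T_k\in\mathcal{DST}_0(2n-1)$, $\psi(T_k)\in ESG(n)$, and $\psi(T_k)=G_{S_k}$ with $$S_k=\left(\binom{k-n+2j-1}{2k}+\binom{k+n-2j}{2k-2j+3}+\binom{k-n+2}{2k-2n+2j+2}\bmod 2\right)_{1\le j\le n-1}.$$ (i) If $n$ is odd, the family $\psi(T_k)$, $0\le k\le\lfloor\frac{n-1}{3}\rfloor-1$, is a basis of $PRSG(n)$. (ii)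 If $n$ is even, let $S^*=(0,\dots,0,1)$ be the sequence of length $n-1$ whose only nonzero term is the last one. Then $OSG(n)=ESG(n)+G_{S^*}$, and $G_{S^*}$ together with the family $\psi(T_k)$, $0\le k\le\lfloor\frac{n-1}{3}\rfloor-1$, is a basis of $PRSG(n)$. -/

import Mathlib

namespace Steinhaus

/-! ### Generalized binomial coefficients -/

/-- The binomial coefficient `a choose b` for all integers `a` and `b`: it is `0` for `b < 0`, and
for `b ≥ 0` it is the generalized binomial coefficient `a (a - 1) ⋯ (a - b + 1) / b!`. The lemmas
below give its defining recursion. -/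
def binomZ (a b : ℤ) : ℤ := if 0 ≤ b then Ring.choose a b.toNat else 0

theorem binomZ_zero_right (a : ℤ) : binomZ a 0 = 1 := by
  simp [binomZ]

theorem binomZ_zero_left (b : ℤ) (hb : 0 < b) : binomZ 0 b = 0 := by
  obtain ⟨m, rfl⟩ := Int.eq_ofNat_of_zero_le hb.le
  have hm : 0 < m := by exact_mod_cast hb
  simp [binomZ, Ring.choose_zero_pos ℤ hm]

theorem binomZ_pascal (a b : ℤ) :
    binomZ a b = binomZ (a - 1) (b - 1) + binomZ (a - 1) b := by
  rcases lt_trichotomy b 0 with hb | rfl | hb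
  · rw [binomZ, binomZ, binomZ, if_neg (by omega), if_neg (by omega), if_neg (by omega), add_zero]
  · simp [binomZ]
  · obtain ⟨m, rfl⟩ : ∃ m : ℕ, b = m + 1 := ⟨(b - 1).toNat, by omega⟩
    have h := Ring.choose_succ_succ (a - 1) m
    rw [sub_add_cancel] at h
    have h1 : ((m : ℤ) + 1).toNat = m + 1 := by omega
    have h2 : (0 : ℤ) ≤ (m : ℤ) + 1 := by omega
    simp [binomZ, h1, h2, h]

/-! ### Steinhaus triangles

Binary sequences `(a_1, …, a_n)` are functions `S : Fin n → ZMod 2`, with `a_j = S (j - 1)`. -/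

/-- The set of indices `(i, j)` with `1 ≤ i ≤ j ≤ n` of a triangle of size `n`. -/
abbrev TriIdx (n : ℕ) : Type := {p : ℕ × ℕ // 1 ≤ p.1 ∧ p.1 ≤ p.2 ∧ p.2 ≤ n}

/-- The space of binary Steinhaus triangles `(a_{i,j})_{1 ≤ i ≤ j ≤ n}` of size `n`: the local rule
`a_{i,j} = a_{i-1,j-1} + a_{i-1,j}` holds for all `2 ≤ i ≤ j ≤ n`. -/
def STri (n : ℕ) : Submodule (ZMod 2) (TriIdx n → ZMod 2) where
  carrier := {a | ∀ (i j : ℕ) (hi : 2 ≤ i) (hij : i ≤ j) (hj : j ≤ n),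
    a ⟨(i, j), by dsimp only; omega⟩ =
      a ⟨(i - 1, j - 1), by dsimp only; omega⟩ + a ⟨(i - 1, j), by dsimp only; omega⟩}
  add_mem' := by
    intro a b ha hb i j hi hij hj
    simp only [Pi.add_apply]
    rw [ha i j hi hij hj, hb i j hi hij hj]
    ring
  zero_mem' := by
    intro i j hi hij hj
    simp
  smul_mem' := by
    intro c a ha i j hi hij hj
    simp only [Pi.smul_apply, smul_eq_mul]
    rw [ha i j hi hij hj]
    ring

/-- The term `a_j` (`1 ≤ j ≤ n`) of a sequence of length `n`; it is `0` outside this range. -/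
def term {n : ℕ} (S : Fin n → ZMod 2) (j : ℕ) : ZMod 2 :=
  if h : 1 ≤ j ∧ j ≤ n then S ⟨j - 1, by omega⟩ else 0

/-- The entries `a_{i,j}`, `1 ≤ i ≤ j ≤ n`, of the Steinhaus triangle with first row `S`. -/
def triEntry {n : ℕ} (S : Fin n → ZMod 2) : ℕ → ℕ → ZMod 2
  | 0, _ => 0
  | 1, j => term S j
  | i + 2, j => triEntry S (i + 1) (j - 1) + triEntry S (i + 1) j

/-- The Steinhaus triangle whose first row is the sequence `S`. -/
def nabla {n : ℕ} (S : Fin n → ZMod 2) : STri n :=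
  ⟨fun p => triEntry S p.1.1 p.1.2, by
    intro i j hi hij hj
    obtain ⟨i, rfl⟩ := Nat.exists_eq_add_of_le' hi
    rfl⟩

/-- The rotation `(a_{i,j}) ↦ (a_{j-i+1,n-i+1})` of Steinhaus triangles of size `n`. -/
def rot (n : ℕ) : STri n →ₗ[ZMod 2] STri n where
  toFun a := ⟨fun p => a.1 ⟨(p.1.2 - p.1.1 + 1, n - p.1.1 + 1), by
      have := p.2
      dsimp only
      omega⟩, by
    intro i j hi hij hj
    have h := a.2 (j - i + 2) (n - i + 2) (by omega) (by omega) (by omega)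
    have e1 : j - (i - 1) + 1 = j - i + 2 := by omega
    have e2 : n - (i - 1) + 1 = n - i + 2 := by omega
    have e3 : j - 1 - (i - 1) + 1 = j - i + 1 := by omega
    simp only [e1, e2, e3]
    rw [h]
    simp only [show j - i + 2 - 1 = j - i + 1 by omega,
      show n - i + 2 - 1 = n - i + 1 by omega]
    have key : ∀ x y : ZMod 2, x = y + (x + y) := by decide
    exact key _ _⟩
  map_add' a b := rfl
  map_smul' c a := rfl

/-- The horizontal reflection `(a_{i,j}) ↦ (a_{i,n-j+i})` of Steinhaus triangles of size `n`. -/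
def hrefl (n : ℕ) : STri n →ₗ[ZMod 2] STri n where
  toFun a := ⟨fun p => a.1 ⟨(p.1.1, n - p.1.2 + p.1.1), by
      have := p.2
      dsimp only
      omega⟩, by
    intro i j hi hij hj
    have h := a.2 i (n - j + i) (by omega) (by omega) (by omega)
    have e1 : n - (j - 1) + (i - 1) = n - j + i := by omega
    have e2 : n - j + (i - 1) = n - j + i - 1 := by omega
    simp only [e1, e2]
    rw [h]
    ring⟩
  map_add' a b := rfl
  map_smul' c a := rfl

/-- The map `ρ = r² + r + id`, where `r` is the rotation. -/
def rho (n : ℕ) : STri n →ₗ[ZMod 2] STri n := rot n ∘ₗ rot n + rot n + LinearMap.id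

/-- The space of dihedrally symmetric Steinhaus triangles of size `n`. -/
def DST (n : ℕ) : Submodule (ZMod 2) (STri n) :=
  LinearMap.ker (rot n - LinearMap.id) ⊓ LinearMap.ker (hrefl n - LinearMap.id)

/-- The space of dihedrally symmetric Steinhaus triangles of size `n` whose first row has an even
number of ones. -/
def DSTz (n : ℕ) : Submodule (ZMod 2) (STri n) where
  carrier := {a | a ∈ DST n ∧
    ∑ j : Fin n, a.1 ⟨(1, j.val + 1), by have := j.2; dsimp only; omega⟩ = 0}
  add_mem' := by
    rintro a b ⟨ha, ha'⟩ ⟨hb, hb'⟩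
    refine ⟨add_mem ha hb, ?_⟩
    simp only [Submodule.coe_add, Pi.add_apply, Finset.sum_add_distrib, ha', hb', add_zero]
  zero_mem' := ⟨zero_mem _, by simp⟩
  smul_mem' := by
    rintro c a ⟨ha, ha'⟩
    refine ⟨Submodule.smul_mem _ c ha, ?_⟩
    simp only [Submodule.coe_smul, Pi.smul_apply, ← Finset.smul_sum, ha', smul_zero]

/-- The sequence `(binom(l + j - 1, k) mod 2)_{1 ≤ j ≤ n}`. -/
def BS (n : ℕ) (k l : ℤ) : Fin n → ZMod 2 :=
  fun j => ((binomZ (l + ((j.val : ℤ) + 1) - 1) k : ℤ) : ZMod 2)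

/-! ### The vector space of simple graphs

The sum of two graphs on the same vertex set is the graph whose adjacency matrix is the sum modulo
`2` of their adjacency matrices, i.e. the symmetric difference of their edge sets. -/

instance graphAdd {V : Type*} : Add (SimpleGraph V) := ⟨fun G H => symmDiff G H⟩

instance graphZero {V : Type*} : Zero (SimpleGraph V) := ⟨⊥⟩

instance graphNeg {V : Type*} : Neg (SimpleGraph V) := ⟨fun G => G⟩

/-- Simple graphs on `V` under symmetric difference. -/
instance graphAddCommGroup {V : Type*} : AddCommGroup (SimpleGraph V) where
  add_assoc := symmDiff_assoc
  zero_add := bot_symmDiff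
  add_zero := symmDiff_bot
  neg_add_cancel := symmDiff_self
  add_comm := symmDiff_comm
  nsmul := nsmulRec
  zsmul := zsmulRec

instance graphModule {V : Type*} : Module (ZMod 2) (SimpleGraph V) :=
  AddCommGroup.zmodModule (n := 2) fun G => by
    rw [two_nsmul]
    exact symmDiff_self G

open Classical in
/-- The adjacency matrix over `ZMod 2`, as a linear map. -/
noncomputable def adjMat (n : ℕ) :
    SimpleGraph (Fin n) →ₗ[ZMod 2] Matrix (Fin n) (Fin n) (ZMod 2) :=
  AddMonoidHom.toZModLinearMap 2
    { toFun := fun G => G.adjMatrix (ZMod 2)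
      map_zero' := by
        ext u v
        have h : ¬ (0 : SimpleGraph (Fin n)).Adj u v := fun h => h
        simp [SimpleGraph.adjMatrix_apply, h]
      map_add' := fun G H => by
        ext u v
        have h : (G + H).Adj u v ↔ (G.Adj u v ∧ ¬ H.Adj u v) ∨ (H.Adj u v ∧ ¬ G.Adj u v) :=
          Iff.rfl
        have two : (0 : ZMod 2) = 1 + 1 := by decide
        simp only [SimpleGraph.adjMatrix_apply, Matrix.add_apply, h]
        by_cases h1 : G.Adj u v <;> by_cases h2 : H.Adj u v <;> simp [h1, h2, two] }

/-- The upper-triangular part of the adjacency matrix of a graph of order `n`, read as a triangle of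
size `n - 1`: its entry `(i, j)` is the entry in row `i` and column `j + 1` of the matrix (rows and
columns numbered from `1`). -/
noncomputable def upperTriangle (n : ℕ) :
    SimpleGraph (Fin n) →ₗ[ZMod 2] (TriIdx (n - 1) → ZMod 2) where
  toFun G p := adjMat n G ⟨p.1.1 - 1, by have := p.2; omega⟩ ⟨p.1.2, by have := p.2; omega⟩
  map_add' G H := by
    funext p
    simp
  map_smul' c G := by
    funext p
    simp

/-- The space of Steinhaus graphs of order `n`: the upper-triangular part of the adjacency matrix is
a Steinhaus triangle of size `n - 1`. -/
noncomputable def SG (n : ℕ) : Submodule (ZMod 2) (SimpleGraph (Fin n)) :=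
  (STri (n - 1)).comap (upperTriangle n)

/-- The Steinhaus graph of order `n` associated with a sequence `S = (a_1, …, a_{n-1})`: the
vertices numbered `i < j` (from `1`) are adjacent if and only if the entry `(i, j - 1)` of the
Steinhaus triangle with first row `S` is `1`. -/
def steinhausGraph {n : ℕ} (S : Fin (n - 1) → ZMod 2) : SimpleGraph (Fin n) where
  Adj u v := u ≠ v ∧ triEntry S (min u.val v.val + 1) (max u.val v.val) = 1
  symm := ⟨fun u v h => ⟨h.1.symm, by rw [min_comm, max_comm]; exact h.2⟩⟩
  loopless := ⟨fun _ h => h.1 rfl⟩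

/-! ### Even, odd and parity-regular Steinhaus graphs -/

open Classical in
/-- Every vertex has even degree. -/
def IsEvenGraph {n : ℕ} (G : SimpleGraph (Fin n)) : Prop := ∀ v, Even (G.degree v)

open Classical in
/-- Every vertex has odd degree. -/
def IsOddGraph {n : ℕ} (G : SimpleGraph (Fin n)) : Prop := ∀ v, Odd (G.degree v)

open Classical in
theorem degree_cast {n : ℕ} (G : SimpleGraph (Fin n)) (v : Fin n) :
    (G.degree v : ZMod 2) = ∑ w, adjMat n G v w := by
  have h : ∀ w, adjMat n G v w = G.adjMatrix (ZMod 2) v w := fun _ => rfl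
  simp only [h, SimpleGraph.adjMatrix_apply, Finset.sum_boole]
  rw [← SimpleGraph.card_neighborFinset_eq_degree, SimpleGraph.neighborFinset_eq_filter]

theorem isEvenGraph_iff {n : ℕ} (G : SimpleGraph (Fin n)) :
    IsEvenGraph G ↔ ∀ v, ∑ w, adjMat n G v w = 0 := by
  simp only [IsEvenGraph, ← degree_cast, ZMod.natCast_eq_zero_iff_even]

theorem isOddGraph_iff {n : ℕ} (G : SimpleGraph (Fin n)) :
    IsOddGraph G ↔ ∀ v, ∑ w, adjMat n G v w = 1 := by
  simp only [IsOddGraph, ← degree_cast, ZMod.natCast_eq_one_iff_odd]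

/-- The space of even Steinhaus graphs of order `n`. -/
noncomputable def ESG (n : ℕ) : Submodule (ZMod 2) (SimpleGraph (Fin n)) where
  carrier := {G | G ∈ SG n ∧ IsEvenGraph G}
  add_mem' := by
    rintro G H ⟨hG, hG'⟩ ⟨hH, hH'⟩
    rw [isEvenGraph_iff] at hG' hH'
    refine ⟨add_mem hG hH, (isEvenGraph_iff _).2 fun v => ?_⟩
    simp [Finset.sum_add_distrib, hG' v, hH' v]
  zero_mem' := ⟨zero_mem _, (isEvenGraph_iff _).2 fun v => by simp⟩
  smul_mem' := by
    rintro c G ⟨hG, hG'⟩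
    rw [isEvenGraph_iff] at hG'
    refine ⟨Submodule.smul_mem _ c hG, (isEvenGraph_iff _).2 fun v => ?_⟩
    simp [← Finset.mul_sum, hG' v]

/-- The set of odd Steinhaus graphs of order `n`. -/
def OSG (n : ℕ) : Set (SimpleGraph (Fin n)) := {G | G ∈ SG n ∧ IsOddGraph G}

/-- The space of parity-regular (even or odd) Steinhaus graphs of order `n`. -/
noncomputable def PRSG (n : ℕ) : Submodule (ZMod 2) (SimpleGraph (Fin n)) where
  carrier := (ESG n : Set (SimpleGraph (Fin n))) ∪ OSG n
  add_mem' := by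
    have two : (1 : ZMod 2) + 1 = 0 := by decide
    rintro G H (hG | ⟨hG, hG'⟩) (hH | ⟨hH, hH'⟩)
    · exact Or.inl (add_mem hG hH)
    · have hG' := (isEvenGraph_iff G).1 hG.2
      rw [isOddGraph_iff] at hH'
      refine Or.inr ⟨add_mem hG.1 hH, (isOddGraph_iff _).2 fun v => ?_⟩
      simp [Finset.sum_add_distrib, hG' v, hH' v]
    · have hH' := (isEvenGraph_iff H).1 hH.2
      rw [isOddGraph_iff] at hG'
      refine Or.inr ⟨add_mem hG hH.1, (isOddGraph_iff _).2 fun v => ?_⟩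
      simp [Finset.sum_add_distrib, hG' v, hH' v]
    · rw [isOddGraph_iff] at hG' hH'
      refine Or.inl ⟨add_mem hG hH, (isEvenGraph_iff _).2 fun v => ?_⟩
      simp [Finset.sum_add_distrib, hG' v, hH' v, two]
  zero_mem' := Or.inl (zero_mem _)
  smul_mem' := by
    intro c G hG
    have hc : ∀ c : ZMod 2, c = 0 ∨ c = 1 := by decide
    rcases hc c with rfl | rfl
    · rw [zero_smul]
      exact Or.inl (zero_mem _)
    · rw [one_smul]
      exact hG

/-! ### The explicit families -/

/-- The map `ψ` sending a triangle `(a_{i,j})` of size `2n - 1` to the Steinhaus graph of order `n`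
of the sequence `(a_{2,2j})_{1 ≤ j ≤ n-1}`. -/
def psi (n : ℕ) (a : STri (2 * n - 1)) : SimpleGraph (Fin n) :=
  steinhausGraph fun j : Fin (n - 1) =>
    a.1 ⟨(2, 2 * (j.val + 1)), by have := j.2; dsimp only; omega⟩

/-- The dihedrally symmetric triangle `ρ(∇(BS))` of size `2n - 1`, where `BS` is the sequence
`(binom(k - n + j, 2k + 1) mod 2)_{1 ≤ j ≤ 2n-1}`. -/
def basisTriangle (n k : ℕ) : STri (2 * n - 1) :=
  rho (2 * n - 1) (nabla (BS (2 * n - 1) (2 * k + 1) (k - n + 1)))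

/-- The sequence `S_k = (binom(k-n+2j-1, 2k) + binom(k+n-2j, 2k-2j+3)
+ binom(k-n+2, 2k-2n+2j+2) mod 2)_{1 ≤ j ≤ n-1}`. -/
def seqS (n k : ℕ) : Fin (n - 1) → ZMod 2 := fun j0 =>
  let j : ℤ := (j0.val : ℤ) + 1
  ((binomZ (k - n + 2 * j - 1) (2 * k) + binomZ (k + n - 2 * j) (2 * k - 2 * j + 3)
    + binomZ (k - n + 2) (2 * k - 2 * n + 2 * j + 2) : ℤ) : ZMod 2)

/-- The sequence `(0, …, 0, 1)` of length `n - 1`. -/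
def seqLast (n : ℕ) : Fin (n - 1) → ZMod 2 := fun j => if j.val + 1 = n - 1 then 1 else 0

end Steinhaus

namespace Steinhaus

/-! In barycentric coordinates `u = i - 1`, `v = j - i`, `w = N - j` on a triangle of size `N`, the
local rule becomes `F (u+1) v w + F u (v+1) w + F u v (w+1) = 0`, which is symmetric in the three
coordinates. The proof bounds the dimension of `ESG n` above by `⌊(n-1)/3⌋` and exhibits that many
independent elements.

Upper bound. Row and column sums of a Steinhaus triangle telescope, so even degrees at the inner
vertices give a relation between `F` and two of its reflections on one side of the triangle of
entries off the diagonal (`vertexSum_eq`). The local rule carries it to the whole triangle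
(`IsEvenTriangle.of_side`). Hence `F` is invariant under a reflection and its three rotates sum to
zero. Peeling off boundary layers then shows that `F` vanishes once its entries `F l l (d - 2l)`
with `3l + 1 ≤ d = n - 3` do (`IsEvenTriangle.eq_zero`). These entries are the `⌊(n-1)/3⌋`
adjacencies in `coords`.

Construction. By upper negation modulo 2 the binomial triangle is symmetric under a reflection, so
the sum of its rotates, `T_k`, has full dihedral symmetry. The square of `X + Y + Z` is `X² + Y² +
Z²` over `ZMod 2`, so every second entry of `T_k` again obeys the local rule; this gives all the
entries of `∇ S_k`. Its inner degree conditions are instances of the local rule in `T_k`, and the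
two extreme ones come from the even first row (`vertexSum_seqS`). The matrix of `coords` on the
graphs `ψ(T_k)` is unitriangular, so they form a basis of `ESG n`.

For odd graphs, the handshake lemma excludes odd `n`; for even `n` the star `G_{S*}` is odd, and
adding it exchanges even and odd Steinhaus graphs. -/

theorem zmod_two_eq_of_add_eq_zero : ∀ {x y : ZMod 2}, x + y = 0 → x = y := by decide

/-! ### The Steinhaus rule in barycentric coordinates -/

/-- The Steinhaus rule for a function of three natural numbers with sum `d`. -/
def IsSteinhaus (d : ℕ) (F : ℕ → ℕ → ℕ → ZMod 2) : Prop :=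
  ∀ u v w, u + v + w + 1 = d → F (u + 1) v w + F u (v + 1) w + F u v (w + 1) = 0

theorem IsSteinhaus.eq_zero_of_left {d : ℕ} {F : ℕ → ℕ → ℕ → ZMod 2} (hF : IsSteinhaus d F)
    (h0 : ∀ v w, v + w = d → F 0 v w = 0) (u v w : ℕ) (h : u + v + w = d) : F u v w = 0 := by
  induction u generalizing v w with
  | zero => exact h0 v w (by omega)
  | succ u ih =>
    have := hF u v w (by omega)
    rwa [ih _ _ (by omega), ih _ _ (by omega), add_zero, add_zero] at this

/-- The condition satisfied by the off-diagonal part of an even Steinhaus graph. -/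
structure IsEvenTriangle (d : ℕ) (F : ℕ → ℕ → ℕ → ZMod 2) : Prop where
  rule : IsSteinhaus d F
  sum_refl : ∀ u v w, u + v + w = d → F u v w + F v u w + F u w v = 0

/-- The sum of three reflected copies of `F` obeys the same local rule, because that rule is
symmetric in the coordinates; it therefore vanishes everywhere once it vanishes on the side `v = 0`.
-/
theorem IsEvenTriangle.of_side {d : ℕ} {F : ℕ → ℕ → ℕ → ZMod 2} (hF : IsSteinhaus d F)
    (h : ∀ u w, u + w = d → F u 0 w + F 0 u w + F u w 0 = 0) : IsEvenTriangle d F := by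
  refine ⟨hF, fun u v w huvw => ?_⟩
  refine IsSteinhaus.eq_zero_of_left (F := fun v u w => F u v w + F v u w + F u w v)
    (fun v u w hd => ?_) (fun u w hd => h u w hd) v u w (by omega)
  have h1 := hF u v w (by omega)
  have h2 := hF v u w (by omega)
  have h3 := hF u w v (by omega)
  linear_combination h1 + h2 + h3

theorem IsEvenTriangle.sum_rot {d : ℕ} {F : ℕ → ℕ → ℕ → ZMod 2} (hF : IsEvenTriangle d F)
    (u v w : ℕ) (h : u + v + w = d) : F u v w + F v w u + F w u v = 0 := by
  have h1 := hF.sum_refl u v w h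
  have h2 := hF.sum_refl v u w (by omega)
  have h3 := hF.sum_refl u w v (by omega)
  have key : ∀ a b c x y : ZMod 2,
      a + b + c = 0 → b + a + x = 0 → c + y + a = 0 → a + x + y = 0 := by decide
  exact key _ _ _ _ _ h1 h2 h3

theorem IsEvenTriangle.symm {d : ℕ} {F : ℕ → ℕ → ℕ → ZMod 2} (hF : IsEvenTriangle d F)
    (u v w : ℕ) (h : u + v + w = d) : F u v w = F w v u := by
  have h1 := hF.sum_refl u v w h
  have h2 := hF.sum_rot u w v (by omega)
  have key : ∀ a b c x : ZMod 2, a + b + c = 0 → c + x + b = 0 → a = x := by decide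
  exact key _ _ _ _ h1 h2

/-- Both conditions are homogeneous in position, so they survive removal of the boundary layer,
which lowers `d` by 3. This drives the induction in `IsEvenTriangle.eq_zero`. -/
theorem IsEvenTriangle.inner {d : ℕ} {F : ℕ → ℕ → ℕ → ZMod 2} (hF : IsEvenTriangle (d + 3) F) :
    IsEvenTriangle d fun u v w => F (u + 1) (v + 1) (w + 1) :=
  ⟨fun u v w h => hF.rule (u + 1) (v + 1) (w + 1) (by omega),
    fun u v w h => hF.sum_refl (u + 1) (v + 1) (w + 1) (by omega)⟩

theorem IsEvenTriangle.eq_zero {d : ℕ} {F : ℕ → ℕ → ℕ → ZMod 2} (hF : IsEvenTriangle d F)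
    (h0 : ∀ l, 3 * l + 1 ≤ d → F l l (d - 2 * l) = 0) (u v w : ℕ) (h : u + v + w = d) :
    F u v w = 0 := by
  induction d using Nat.strong_induction_on generalizing F u v w with
  | _ d ih =>
  refine hF.rule.eq_zero_of_left ?_ u v w h
  have three : ∀ x : ZMod 2, x + x + x = 0 → x = 0 := by decide
  rcases Nat.eq_zero_or_pos d with rfl | hd
  · intro v w hvw
    obtain ⟨rfl, rfl⟩ : v = 0 ∧ w = 0 := by omega
    exact three _ (hF.sum_refl 0 0 0 rfl)
  have c1 : F 0 0 d = 0 := h0 0 (by omega)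
  have c2 : F d 0 0 = 0 := by rw [← hF.symm 0 0 d (by omega)]; exact c1
  have c3 : F 0 d 0 = 0 := by
    have := hF.sum_rot 0 0 d (by omega)
    rwa [c1, c2, zero_add, add_zero] at this
  have interior : ∀ u v w, u + v + w + 3 = d → F (u + 1) (v + 1) (w + 1) = 0 := by
    intro u v w h
    obtain ⟨e, rfl⟩ : ∃ e, d = e + 3 := ⟨d - 3, by omega⟩
    refine ih e (by omega) hF.inner (fun l hl => ?_) u v w (by omega)
    have := h0 (l + 1) (by omega)
    rwa [show e + 3 - 2 * (l + 1) = e - 2 * l + 1 by omega] at this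
  -- With the interior zero, the local rule makes neighbouring non-corner entries of the side equal.
  have const : ∀ a c, a + c + 2 = d → F 0 (a + 1) (c + 1) = F 0 1 (d - 1) := by
    intro a
    induction a with
    | zero => intro c hc; rw [show c + 1 = d - 1 by omega]
    | succ a iha =>
      intro c hc
      have h1 := hF.rule 0 (a + 1) (c + 1) (by omega)
      rw [interior 0 a c (by omega), iha (c + 1) (by omega), zero_add] at h1
      exact zmod_two_eq_of_add_eq_zero h1
  intro a c hac
  rcases Nat.eq_zero_or_pos a with rfl | ha
  · rw [show c = d by omega]; exact c1
  rcases Nat.eq_zero_or_pos c with rfl | hc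
  · rw [show a = d by omega]; exact c3
  obtain ⟨a, rfl⟩ : ∃ e, a = e + 1 := ⟨a - 1, by omega⟩
  obtain ⟨c, rfl⟩ : ∃ e, c = e + 1 := ⟨c - 1, by omega⟩
  rw [const a c (by omega)]
  have h1 := hF.rule 0 0 (d - 1) (by omega)
  have h2 := hF.sum_rot 0 1 (d - 1) (by omega)
  have h3 := const (d - 2) 0 (by omega)
  rw [show d - 2 + 1 = d - 1 by omega, zero_add] at h3
  rw [hF.symm 1 (d - 1) 0 (by omega), hF.symm (d - 1) 0 1 (by omega), h3] at h2
  rw [show d - 1 + 1 = d by omega, c1] at h1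
  -- Here `q` is the common value on the side and `p = F 1 0 (d - 1)`. The rule at the corner gives
  -- `p = q`; the rotation sum, after reflections, gives `p = 0`.
  have key : ∀ p q : ZMod 2, p + q + 0 = 0 → q + q + p = 0 → q = 0 := by decide
  exact key _ _ h1 h2

/-! ### The entries of the triangle of a sequence -/

theorem triEntry_rule {n : ℕ} (S : Fin n → ZMod 2) (i j : ℕ) :
    triEntry S (i + 1) j + triEntry S (i + 1) (j + 1) + triEntry S (i + 2) (j + 1) = 0 := by
  rw [triEntry, Nat.add_sub_cancel]
  exact CharTwo.add_self_eq_zero _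

/-- The entries strictly above the diagonal, in barycentric coordinates. -/
def offDiag {n : ℕ} (S : Fin n → ZMod 2) (u v _w : ℕ) : ZMod 2 := triEntry S (u + 1) (u + v + 2)

theorem isSteinhaus_offDiag {n : ℕ} (S : Fin n → ZMod 2) (d : ℕ) : IsSteinhaus d (offDiag S) := by
  intro u v w _
  have h := triEntry_rule S u (u + v + 2)
  simp only [offDiag]
  rw [show u + 1 + v + 2 = u + v + 2 + 1 by omega, show u + (v + 1) + 2 = u + v + 2 + 1 by omega]
  linear_combination h

/-- The degree modulo `2` of the vertex numbered `v + 1`. -/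
def vertexSum {n : ℕ} (S : Fin (n - 1) → ZMod 2) (v : ℕ) : ZMod 2 :=
  ∑ s ∈ Finset.range v, triEntry S (s + 1) v + ∑ w ∈ Finset.Ico (v + 1) n, triEntry S (v + 1) w

theorem sum_column {n : ℕ} (S : Fin n → ZMod 2) (v m : ℕ) :
    ∑ s ∈ Finset.range m, triEntry S (s + 1) v
      = triEntry S 1 (v + 1) + triEntry S (m + 1) (v + 1) := by
  induction m with
  | zero => simp [CharTwo.add_self_eq_zero]
  | succ m ih =>
    rw [Finset.sum_range_succ, ih]
    have := triEntry_rule S m v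
    have two : (2 : ZMod 2) = 0 := by decide
    linear_combination this - two * triEntry S (m + 2) (v + 1)

theorem sum_row {n : ℕ} (S : Fin n → ZMod 2) (i a b : ℕ) (h : a ≤ b) :
    ∑ w ∈ Finset.Ico (a + 1) (b + 1), triEntry S (i + 2) w
      = triEntry S (i + 1) a + triEntry S (i + 1) b := by
  induction b, h using Nat.le_induction with
  | base => simp [CharTwo.add_self_eq_zero]
  | succ b hb ih =>
    rw [Finset.sum_Ico_succ_top (by omega), ih]
    have := triEntry_rule S i b
    have two : (2 : ZMod 2) = 0 := by decide
    linear_combination this - two * triEntry S (i + 1) (b + 1)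

/-- After both sums telescope, two diagonal entries remain; the local rule merges them into the
entry `offDiag S u 0 w`, so the diagonal drops out. -/
theorem vertexSum_eq {n : ℕ} (S : Fin (n - 1) → ZMod 2) (u w : ℕ) (h : u + w + 3 = n) :
    vertexSum S (u + 1) = offDiag S u 0 w + offDiag S 0 u w + offDiag S u w 0 := by
  subst h
  have h2 := sum_row S u (u + 1) (u + w + 2) (by omega)
  have h3 := triEntry_rule S u (u + 1)
  have two : (2 : ZMod 2) = 0 := by decide
  rw [vertexSum, sum_column, h2]
  simp only [offDiag, add_zero, zero_add]
  linear_combination h3 - two * triEntry S (u + 1) (u + 1 + 1)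

theorem isEvenTriangle_offDiag {n : ℕ} {S : Fin (n - 1) → ZMod 2}
    (hS : ∀ v < n, vertexSum S v = 0) (d : ℕ) (hd : d + 3 = n) : IsEvenTriangle d (offDiag S) :=
  .of_side (isSteinhaus_offDiag S d) fun u w h => by
    rw [← vertexSum_eq S u w (by omega)]
    exact hS _ (by omega)

theorem eq_zero_of_vertexSum {n : ℕ} {S : Fin (n - 1) → ZMod 2}
    (hS : ∀ v < n, vertexSum S v = 0)
    (h0 : ∀ l < (n - 1) / 3, triEntry S (l + 1) (2 * l + 2) = 0) : S = 0 := by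
  have hterm : ∀ j : Fin (n - 1), triEntry S 1 (j.val + 1) = S j := by
    intro j
    have := j.2
    rw [triEntry, term, dif_pos (by omega)]
    rfl
  have h1 : ∀ j, 2 ≤ j → j < n → triEntry S 1 j = 0 := by
    intro j hj hjn
    have := (isEvenTriangle_offDiag hS (n - 3) (by omega)).eq_zero (fun l hl => by
      simp only [offDiag]
      rw [show l + l + 2 = 2 * l + 2 by omega]
      exact h0 l (by omega)) 0 (j - 2) (n - 1 - j) (by omega)
    rwa [offDiag, show 0 + (j - 2) + 2 = j by omega] at this
  funext j
  rw [← hterm, Pi.zero_apply]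
  -- The first term lies on the diagonal, out of reach of `offDiag`; as the other terms vanish, it
  -- equals the degree of the first vertex modulo 2.
  rcases Nat.eq_zero_or_pos j.val with hj | hj
  · have hn := j.2
    have h := hS 0 (by omega)
    rw [vertexSum, Finset.range_zero, Finset.sum_empty, zero_add,
      Finset.sum_eq_sum_Ico_succ_bot (by omega), Finset.sum_eq_zero, add_zero] at h
    · rw [hj]; exact h
    · intro w hw
      rw [Finset.mem_Ico] at hw
      exact h1 w (by omega) (by omega)
  · exact h1 _ (by omega) (by omega)

/-! ### The entries of the triangles `T_k` -/

/-- Upper negation, whose sign `(-1)^b` disappears modulo 2. -/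
theorem binomZ_upper_neg (a b : ℤ) :
    ((binomZ a b : ℤ) : ZMod 2) = ((binomZ (b - 1 - a) b : ℤ) : ZMod 2) := by
  unfold binomZ
  split_ifs with hb
  · obtain ⟨m, rfl⟩ := Int.eq_ofNat_of_zero_le hb
    have h := Ring.choose_neg (-a) m
    rw [neg_neg, show -a + (m : ℤ) - 1 = m - 1 - a by ring] at h
    rw [Int.toNat_natCast, h]
    rcases Int.units_eq_one_or (Int.negOnePow m) with h1 | h1 <;> simp [h1, Units.smul_def]
  · rfl

/-- The entry with barycentric coordinates `u, v, 2n - 2 - u - v` of the triangle with first row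
`(binom(k - n + j, 2k + 1))`. -/
def binomEntry (n k : ℕ) (u v : ℤ) : ZMod 2 := ((binomZ (v - n + 1 + k) (2 * k + 1 - u) : ℤ) : ZMod 2)

theorem binomEntry_rule (n k : ℕ) (u v : ℤ) :
    binomEntry n k (u + 1) v + binomEntry n k u (v + 1) + binomEntry n k u v = 0 := by
  simp only [binomEntry]
  rw [binomZ_pascal (v + 1 - n + 1 + k),
    show v + 1 - (n : ℤ) + 1 + k - 1 = v - n + 1 + k by ring,
    show 2 * (k : ℤ) + 1 - (u + 1) = 2 * k + 1 - u - 1 by ring]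
  push_cast
  have key : ∀ x y : ZMod 2, x + (x + y) + y = 0 := by decide
  exact key _ _

theorem binomEntry_swap (n k : ℕ) {u v w : ℤ} (h : u + v + w = 2 * n - 2) :
    binomEntry n k u v = binomEntry n k u w := by
  rw [binomEntry, binomZ_upper_neg, binomEntry]
  congr 3
  linarith

theorem triEntry_BS (n k : ℕ) (i j : ℕ) (hi : 1 ≤ i) (hij : i ≤ j) (hj : j ≤ 2 * n - 1) :
    triEntry (BS (2 * n - 1) (2 * k + 1) (k - n + 1)) i j = binomEntry n k (i - 1) (j - i) := by
  induction i, hi using Nat.le_induction generalizing j with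
  | base =>
    rw [triEntry, term, dif_pos ⟨hij, hj⟩, BS, binomEntry]
    push_cast [hij]
    congr 3
    ring
  | succ i hi ih =>
    obtain ⟨i, rfl⟩ := Nat.exists_eq_add_of_le' hi
    rw [triEntry, ih _ (by omega) (by omega), ih _ (by omega) (by omega)]
    have h := binomEntry_rule n k i (j - i - 2)
    push_cast [show 1 ≤ j by omega]
    rw [show (j : ℤ) - i - 2 + 1 = j - (i + 1) by ring,
      show (j : ℤ) - i - 2 = j - (i + 1 + 1) by ring] at h
    rw [show (j : ℤ) - 1 - (i + 1) = j - (i + 1 + 1) by ring, add_sub_cancel_right,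
      add_sub_cancel_right]
    have key : ∀ x y z : ZMod 2, x + y + z = 0 → z + y = x := by decide
    exact key _ _ _ h

/-- The entry with barycentric coordinates `u, v, w` of the triangle `T_k`. -/
def rotEntry (n k : ℕ) (u v w : ℤ) : ZMod 2 :=
  binomEntry n k u v + binomEntry n k v w + binomEntry n k w u

theorem rotEntry_rule (n k : ℕ) (u v w : ℤ) :
    rotEntry n k (u + 1) v w + rotEntry n k u (v + 1) w + rotEntry n k u v (w + 1) = 0 := by
  simp only [rotEntry]
  linear_combination binomEntry_rule n k u v + binomEntry_rule n k v w + binomEntry_rule n k w u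

/-- Apply the local rule to itself: the mixed terms occur twice and cancel. -/
theorem rotEntry_rule_two (n k : ℕ) (u v w : ℤ) :
    rotEntry n k (u + 2) v w + rotEntry n k u (v + 2) w + rotEntry n k u v (w + 2) = 0 := by
  have h1 := rotEntry_rule n k (u + 1) v w
  have h2 := rotEntry_rule n k u (v + 1) w
  have h3 := rotEntry_rule n k u v (w + 1)
  have two : (2 : ZMod 2) = 0 := by decide
  rw [show u + 1 + 1 = u + 2 by ring] at h1
  rw [show v + 1 + 1 = v + 2 by ring] at h2
  rw [show w + 1 + 1 = w + 2 by ring] at h3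
  linear_combination h1 + h2 + h3 - two * (rotEntry n k (u + 1) (v + 1) w
    + rotEntry n k (u + 1) v (w + 1) + rotEntry n k u (v + 1) (w + 1))

theorem rotEntry_rot (n k : ℕ) (u v w : ℤ) : rotEntry n k v w u = rotEntry n k u v w := by
  simp only [rotEntry]
  ring

/-- By `binomEntry_swap`, each of the three summands depends only on its first coordinate once the
total is `2n - 2`, so permuting coordinates only permutes the summands. -/
theorem rotEntry_swap (n k : ℕ) {u v w : ℤ} (h : u + v + w = 2 * n - 2) :
    rotEntry n k u w v = rotEntry n k u v w := by
  simp only [rotEntry]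
  rw [binomEntry_swap n k (u := u) (v := w) (w := v) (by linarith),
    binomEntry_swap n k (u := w) (v := v) (w := u) (by linarith),
    binomEntry_swap n k (u := v) (v := u) (w := w) (by linarith)]
  ring

theorem rotEntry_swap_left (n k : ℕ) {u v w : ℤ} (h : u + v + w = 2 * n - 2) :
    rotEntry n k v u w = rotEntry n k u v w :=
  (rotEntry_rot n k w v u).trans
    ((rotEntry_swap n k (by linarith)).trans (rotEntry_rot n k w u v).symm)

theorem basisTriangle_apply (n k : ℕ) (p : TriIdx (2 * n - 1)) :
    (basisTriangle n k).1 p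
      = rotEntry n k (p.1.1 - 1) (p.1.2 - p.1.1) (2 * n - 1 - p.1.2) := by
  obtain ⟨⟨i, j⟩, h1, h2, h3⟩ := p
  dsimp only at h1 h2 h3
  have e : (basisTriangle n k).1 ⟨(i, j), h1, h2, h3⟩ =
    triEntry (BS (2 * n - 1) (2 * k + 1) (k - n + 1))
      (2 * n - 1 - i + 1 - (j - i + 1) + 1) (2 * n - 1 - (j - i + 1) + 1)
    + triEntry (BS (2 * n - 1) (2 * k + 1) (k - n + 1)) (j - i + 1) (2 * n - 1 - i + 1)
    + triEntry (BS (2 * n - 1) (2 * k + 1) (k - n + 1)) i j := rfl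
  rw [e, triEntry_BS _ _ _ _ (by omega) (by omega) (by omega),
    triEntry_BS _ _ _ _ (by omega) (by omega) (by omega), triEntry_BS _ _ _ _ h1 h2 h3, rotEntry]
  rw [show ((2 * n - 1 - i + 1 - (j - i + 1) + 1 : ℕ) : ℤ) - 1 = 2 * n - 1 - j by omega,
    show ((2 * n - 1 - (j - i + 1) + 1 : ℕ) : ℤ) - (2 * n - 1 - i + 1 - (j - i + 1) + 1 : ℕ)
      = i - 1 by omega,
    show ((j - i + 1 : ℕ) : ℤ) - 1 = j - i by omega,
    show ((2 * n - 1 - i + 1 : ℕ) : ℤ) - (j - i + 1 : ℕ) = 2 * n - 1 - j by omega]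
  ring

/-- A symmetric family over an interval of odd length sums to its middle term. -/
theorem sum_range_symm (m : ℕ) (f : ℕ → ZMod 2) (h : ∀ j ≤ 2 * m, f (2 * m - j) = f j) :
    ∑ j ∈ Finset.range (2 * m + 1), f j = f m := by
  induction m generalizing f with
  | zero => simp
  | succ m ih =>
    rw [show 2 * (m + 1) + 1 = 2 * m + 1 + 1 + 1 by ring, Finset.sum_range_succ,
      Finset.sum_range_succ', ih (fun j => f (j + 1))]
    · have := h 0 (by omega)
      rw [show 2 * (m + 1) - 0 = 2 * m + 1 + 1 by omega] at this
      rw [this, add_assoc, CharTwo.add_self_eq_zero, add_zero]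
    · intro j hj
      have := h (j + 1) (by omega)
      rwa [show 2 * (m + 1) - (j + 1) = 2 * m - j + 1 by omega] at this

theorem sum_rotEntry (n k : ℕ) (hn : 1 ≤ n) :
    ∑ j ∈ Finset.range (2 * n - 1), rotEntry n k 0 j (2 * n - 2 - j) = 0 := by
  obtain ⟨n, rfl⟩ := Nat.exists_eq_add_of_le' hn
  rw [show 2 * (n + 1) - 1 = 2 * n + 1 by omega,
    sum_range_symm n (fun j => rotEntry (n + 1) k 0 j (2 * (n + 1 : ℕ) - 2 - j))]
  -- In the middle term two rotated entries cancel, leaving `binom(k, 2k + 1) = 0`.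
  · rw [show 2 * ((n + 1 : ℕ) : ℤ) - 2 - n = n by push_cast; ring, rotEntry,
      binomEntry_swap (n + 1) k (u := n) (v := n) (w := 0) (by push_cast; ring), add_assoc,
      CharTwo.add_self_eq_zero, add_zero, binomEntry]
    rw [show (n : ℤ) - (n + 1 : ℕ) + 1 + k = k by push_cast; ring, binomZ_upper_neg]
    rw [show 2 * (k : ℤ) + 1 - 0 - 1 - k = k by ring, binomZ, if_pos (by omega), Ring.choose_natCast,
      Nat.choose_eq_zero_of_lt (by omega)]
    simp
  · intro j hj
    refine Eq.trans ?_ (rotEntry_swap (n + 1) k (by ring))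
    congr 1 <;> push_cast [hj] <;> ring

theorem basisTriangle_mem_DSTz (n k : ℕ) (hn : 1 ≤ n) : basisTriangle n k ∈ DSTz (2 * n - 1) := by
  refine ⟨⟨?_, ?_⟩, ?_⟩
  · simp only [SetLike.mem_coe, LinearMap.mem_ker, LinearMap.sub_apply, LinearMap.id_apply,
      sub_eq_zero]
    refine Subtype.ext (funext fun p => ?_)
    have hp := p.2
    change (basisTriangle n k).1 ⟨(p.1.2 - p.1.1 + 1, 2 * n - 1 - p.1.1 + 1), _⟩ = _
    rw [basisTriangle_apply, basisTriangle_apply]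
    refine Eq.trans ?_ (rotEntry_rot n k _ _ _)
    dsimp only
    congr 1 <;> omega
  · simp only [SetLike.mem_coe, LinearMap.mem_ker, LinearMap.sub_apply, LinearMap.id_apply,
      sub_eq_zero]
    refine Subtype.ext (funext fun p => ?_)
    have hp := p.2
    change (basisTriangle n k).1 ⟨(p.1.1, 2 * n - 1 - p.1.2 + p.1.1), _⟩ = _
    rw [basisTriangle_apply, basisTriangle_apply]
    refine Eq.trans ?_ (rotEntry_swap n k (by ring))
    dsimp only
    congr 1 <;> omega
  · rw [← sum_rotEntry n k hn, ← Fin.sum_univ_eq_sum_range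
      (fun j : ℕ => rotEntry n k 0 j (2 * n - 2 - j))]
    refine Finset.sum_congr rfl fun j _ => ?_
    rw [basisTriangle_apply]
    congr 1 <;> push_cast <;> ring

/-! ### The sequences of the graphs `ψ(T_k)` -/

theorem seqS_apply (n k : ℕ) (j : Fin (n - 1)) :
    seqS n k j = rotEntry n k 1 (2 * j) (2 * n - 3 - 2 * j) := by
  rw [seqS, rotEntry, binomEntry, binomEntry, binomEntry]
  push_cast
  congr 1
  · congr 1
    · congr 2 <;> ring
    · congr 2 <;> ring
  · congr 2 <;> ring

theorem psi_basisTriangle (n k : ℕ) : psi n (basisTriangle n k) = steinhausGraph (seqS n k) := by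
  unfold psi
  congr 1
  funext j
  rw [basisTriangle_apply, seqS_apply]
  congr 1 <;> push_cast <;> ring

theorem triEntry_seqS (n k : ℕ) (i j : ℕ) (hi : 1 ≤ i) (hij : i ≤ j) (hj : j ≤ n - 1) :
    triEntry (seqS n k) i j = rotEntry n k (2 * i - 1) (2 * j - 2 * i) (2 * n - 1 - 2 * j) := by
  induction i, hi using Nat.le_induction generalizing j with
  | base =>
    rw [triEntry, term, dif_pos ⟨hij, hj⟩, seqS_apply]
    push_cast [hij]
    congr 1 <;> ring
  | succ i hi ih =>
    obtain ⟨i, rfl⟩ := Nat.exists_eq_add_of_le' hi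
    rw [triEntry, ih _ (by omega) (by omega), ih _ (by omega) (by omega)]
    have h := rotEntry_rule_two n k (2 * i + 1) (2 * j - 2 * i - 4) (2 * n - 1 - 2 * j)
    push_cast [show 1 ≤ j by omega]
    rw [show (2 : ℤ) * (i + 1) - 1 = 2 * i + 1 by ring,
      show (2 : ℤ) * (j - 1) - 2 * (i + 1) = 2 * j - 2 * i - 4 by ring,
      show (2 : ℤ) * n - 1 - 2 * (j - 1) = 2 * n - 1 - 2 * j + 2 by ring,
      show (2 : ℤ) * j - 2 * (i + 1) = 2 * j - 2 * i - 4 + 2 by ring,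
      show (2 : ℤ) * (i + 1 + 1) - 1 = 2 * i + 1 + 2 by ring,
      show (2 : ℤ) * j - 2 * (i + 1 + 1) = 2 * j - 2 * i - 4 by ring]
    have key : ∀ x y z : ZMod 2, x + y + z = 0 → z + y = x := by decide
    exact key _ _ _ h

theorem rotEntry_corner (n k : ℕ) (hk : k + 1 < n) : rotEntry n k 0 (2 * n - 2) 0 = 0 := by
  rw [rotEntry, binomEntry_swap n k (u := 0) (v := 2 * n - 2) (w := 0) (by ring), add_right_comm,
    CharTwo.add_self_eq_zero, zero_add, binomEntry, binomZ, if_neg (by omega), Int.cast_zero]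

/-- By the local rule each summand is the sum of two consecutive first-row entries of `T_k`. These
pairs exhaust the row up to its last corner, which is zero, and the row sum is even. -/
theorem sum_rotEntry_one (n k : ℕ) (hk : k + 1 < n) :
    ∑ j ∈ Finset.range (n - 1), rotEntry n k 1 (2 * j) (2 * n - 3 - 2 * j) = 0 := by
  have h := sum_rotEntry n k (by omega)
  have pair : ∀ (m : ℕ) (f : ℕ → ZMod 2),
      ∑ j ∈ Finset.range (2 * m), f j = ∑ j ∈ Finset.range m, (f (2 * j) + f (2 * j + 1)) := by
    intro m f
    induction m with
    | zero => simp
    | succ m ih =>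
      rw [Finset.sum_range_succ _ m, ← ih, show 2 * (m + 1) = 2 * m + 1 + 1 by ring,
        Finset.sum_range_succ, Finset.sum_range_succ, add_assoc]
  rw [show 2 * n - 1 = 2 * (n - 1) + 1 by omega, Finset.sum_range_succ, pair] at h
  rw [show ((2 * (n - 1) : ℕ) : ℤ) = 2 * n - 2 by omega, sub_self, rotEntry_corner n k hk,
    add_zero] at h
  rw [← h]
  refine Finset.sum_congr rfl fun j _ => ?_
  have hr := rotEntry_rule n k 0 (2 * j) (2 * n - 3 - 2 * j)
  rw [zero_add, add_assoc] at hr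
  rw [zmod_two_eq_of_add_eq_zero hr, add_comm]
  push_cast
  congr 2 <;> ring

theorem vertexSum_seqS (n k : ℕ) (hk : k + 1 < n) (v : ℕ) (hv : v < n) :
    vertexSum (seqS n k) v = 0 := by
  have hsum := sum_rotEntry_one n k hk
  rcases Nat.eq_zero_or_pos v with rfl | hv0
  · rw [vertexSum, Finset.range_zero, Finset.sum_empty, zero_add, Finset.sum_Ico_eq_sum_range,
      ← hsum]
    refine Finset.sum_congr rfl fun j hj => ?_
    rw [Finset.mem_range] at hj
    rw [triEntry_seqS _ _ _ _ le_rfl (by omega) (by omega)]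
    push_cast
    congr 1 <;> ring
  obtain ⟨u, rfl⟩ : ∃ u, v = u + 1 := ⟨v - 1, by omega⟩
  rcases Nat.lt_or_ge (u + 2) n with hu | hu
  · obtain ⟨w, rfl⟩ : ∃ w, n = u + w + 3 := ⟨n - u - 3, by omega⟩
    have e1 : offDiag (seqS (u + w + 3) k) u 0 w
        = rotEntry (u + w + 3) k (1 + 1) (2 * u + 1) (2 * w + 1) := by
      rw [offDiag, triEntry_seqS _ _ _ _ (by omega) (by omega) (by omega)]
      refine Eq.trans ?_ (rotEntry_swap_left _ _ (by push_cast; ring))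
      congr 1 <;> push_cast <;> ring
    have e2 : offDiag (seqS (u + w + 3) k) 0 u w
        = rotEntry (u + w + 3) k 1 (2 * u + 1 + 1) (2 * w + 1) := by
      rw [offDiag, triEntry_seqS _ _ _ _ (by omega) (by omega) (by omega)]
      congr 1 <;> push_cast <;> ring
    have e3 : offDiag (seqS (u + w + 3) k) u w 0
        = rotEntry (u + w + 3) k 1 (2 * u + 1) (2 * w + 1 + 1) := by
      rw [offDiag, triEntry_seqS _ _ _ _ (by omega) (by omega) (by omega)]
      refine Eq.trans ?_ (rotEntry_rot _ _ _ _ _)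
      congr 1 <;> push_cast <;> ring
    -- The symmetries of `T_k` have turned the three terms into one instance of its local rule, at
    -- `(1, 2u + 1, 2w + 1)`.
    rw [vertexSum_eq _ u w rfl, e1, e2, e3]
    exact rotEntry_rule _ _ _ _ _
  -- The last vertex has only a column sum; a dihedral symmetry of `T_k` turns it into the first-row
  -- sum, read backwards.
  · obtain rfl : n = u + 2 := by omega
    rw [vertexSum, Finset.Ico_self, Finset.sum_empty, add_zero, ← hsum, ← Finset.sum_range_reflect]
    refine Finset.sum_congr rfl fun j hj => ?_
    rw [Finset.mem_range] at hj
    rw [triEntry_seqS _ _ _ _ (by omega) (by omega) (by omega)]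
    refine Eq.trans ?_ (rotEntry_swap _ _ (by ring))
    refine Eq.trans ?_ (rotEntry_rot _ _ _ _ _)
    congr 1 <;> omega

/-- The three binomials have lower indices `2(k - l)`, `2(k - l) - 1` and `2k + 4l + 6 - 2n`. The
last two are negative under the hypotheses, and the first is zero or negative according to whether
`k = l` or `k < l`. -/
theorem triEntry_seqS_diag {n k l : ℕ} (hl : 3 * l + 3 < n) (hkl : k ≤ l) :
    triEntry (seqS n k) (l + 1) (2 * l + 2) = if k = l then 1 else 0 := by
  rw [triEntry_seqS _ _ _ _ (by omega) (by omega) (by omega), rotEntry, binomEntry, binomEntry,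
    binomEntry]
  push_cast
  split_ifs with h
  · subst h
    rw [show 2 * (k : ℤ) + 1 - (2 * (k + 1) - 1) = 0 by ring, binomZ_zero_right,
      binomZ, if_neg (by omega), binomZ, if_neg (by omega)]
    simp
  · rw [binomZ, if_neg (by omega), binomZ, if_neg (by omega), binomZ, if_neg (by omega)]
    simp

/-! ### Steinhaus graphs and their sequences -/

theorem adjMat_apply {n : ℕ} (G : SimpleGraph (Fin n)) (u v : Fin n) :
    adjMat n G u v = open Classical in if G.Adj u v then 1 else 0 := by
  classical
  change G.adjMatrix (ZMod 2) u v = _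
  rw [SimpleGraph.adjMatrix_apply]

theorem adjMat_comm {n : ℕ} (G : SimpleGraph (Fin n)) (u v : Fin n) :
    adjMat n G u v = adjMat n G v u := by
  rw [adjMat_apply, adjMat_apply, SimpleGraph.adj_comm]

theorem adjMat_self {n : ℕ} (G : SimpleGraph (Fin n)) (u : Fin n) : adjMat n G u u = 0 := by
  rw [adjMat_apply, if_neg (G.irrefl)]

theorem adjMat_injective (n : ℕ) : Function.Injective (adjMat n) := by
  intro G H h
  ext u v
  have := congrFun (congrFun h u) v
  rw [adjMat_apply, adjMat_apply] at this
  by_cases h1 : G.Adj u v <;> by_cases h2 : H.Adj u v <;> simp_all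

theorem adjMat_steinhausGraph {n : ℕ} (S : Fin (n - 1) → ZMod 2) {u v : Fin n} (h : u < v) :
    adjMat n (steinhausGraph S) u v = triEntry S (u + 1) v := by
  have hadj : (steinhausGraph S).Adj u v ↔ triEntry S (u + 1) v = 1 := by
    change u ≠ v ∧ triEntry S (min u.val v.val + 1) (max u.val v.val) = 1 ↔ _
    rw [min_eq_left (Fin.le_def.1 h.le), max_eq_right (Fin.le_def.1 h.le), and_iff_right h.ne]
  have key : ∀ x : ZMod 2, x ≠ 1 → 0 = x := by decide
  rw [adjMat_apply]
  by_cases hx : triEntry S (u + 1) v = 1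
  · rw [if_pos (hadj.2 hx), hx]
  · rw [if_neg (mt hadj.1 hx), ← key _ hx]

theorem steinhausGraph_mem_SG {n : ℕ} (S : Fin (n - 1) → ZMod 2) : steinhausGraph S ∈ SG n := by
  have : upperTriangle n (steinhausGraph S) = (nabla S).1 := by
    funext p
    obtain ⟨⟨i, j⟩, h1, h2, h3⟩ := p
    dsimp only at h1 h2 h3
    change adjMat n (steinhausGraph S) ⟨i - 1, _⟩ ⟨j, _⟩ = triEntry S i j
    rw [adjMat_steinhausGraph S (by rw [Fin.mk_lt_mk]; omega)]
    congr 1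
    exact Nat.sub_add_cancel h1
  rw [SG, Submodule.mem_comap, this]
  exact (nabla S).2

theorem triEntry_firstRow {N : ℕ} {a : TriIdx N → ZMod 2} (ha : a ∈ STri N) (i j : ℕ) (hi : 1 ≤ i)
    (hij : i ≤ j) (hj : j ≤ N) :
    triEntry (fun j : Fin N => a ⟨(1, j.val + 1), le_rfl, by omega, j.2⟩) i j
      = a ⟨(i, j), hi, hij, hj⟩ := by
  induction i, hi using Nat.le_induction generalizing j with
  | base =>
    rw [triEntry, term, dif_pos ⟨hij, hj⟩]
    congr 3
    exact Nat.sub_add_cancel hij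
  | succ i hi ih =>
    obtain ⟨i, rfl⟩ := Nat.exists_eq_add_of_le' hi
    rw [triEntry, ih _ (by omega) (by omega), ih _ (by omega) (by omega)]
    exact (ha (i + 2) j (by omega) (by omega) hj).symm

theorem exists_eq_steinhausGraph {n : ℕ} {G : SimpleGraph (Fin n)} (hG : G ∈ SG n) :
    ∃ S : Fin (n - 1) → ZMod 2, G = steinhausGraph S := by
  refine ⟨fun j => upperTriangle n G ⟨(1, j.val + 1), le_rfl, by omega, j.2⟩,
    adjMat_injective n ?_⟩
  have key : ∀ u v : Fin n, u < v → adjMat n G u v = adjMat n (steinhausGraph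
      fun j => upperTriangle n G ⟨(1, j.val + 1), le_rfl, by omega, j.2⟩) u v := by
    intro u v h
    have h' : u.val < v.val := h
    rw [adjMat_steinhausGraph _ h, triEntry_firstRow hG _ _ (by omega) h' (by omega)]
    rfl
  ext u v
  rcases lt_trichotomy u v with h | rfl | h
  · exact key u v h
  · rw [adjMat_self, adjMat_self]
  · rw [adjMat_comm, adjMat_comm _ u, key v u h]

theorem sum_adjMat_steinhausGraph {n : ℕ} (S : Fin (n - 1) → ZMod 2) (v : Fin n) :
    ∑ w, adjMat n (steinhausGraph S) v w = vertexSum S v := by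
  have h : ∀ w : Fin n, adjMat n (steinhausGraph S) v w = (fun w : ℕ =>
      if w < v then triEntry S (w + 1) v else if w = v then 0 else triEntry S (v + 1) w) w := by
    intro w
    rcases lt_trichotomy w v with h | rfl | h
    · rw [adjMat_comm, adjMat_steinhausGraph S h]
      simp [h]
    · simp [adjMat_self]
    · have h' : v.val < w.val := h
      rw [adjMat_steinhausGraph S h]
      simp only
      rw [if_neg (by omega), if_neg (by omega)]
  rw [Finset.sum_congr rfl fun w _ => h w, Fin.sum_univ_eq_sum_range (fun w : ℕ =>
      if w < v then triEntry S (w + 1) v else if w = v then 0 else triEntry S (v + 1) w), vertexSum,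
    Finset.range_eq_Ico, ← Finset.sum_Ico_consecutive _ (Nat.zero_le v.val) v.2.le]
  congr 1
  · refine Finset.sum_congr (by rw [Finset.range_eq_Ico]) fun w hw => ?_
    rw [Finset.mem_range] at hw
    exact if_pos hw
  · rw [Finset.sum_eq_sum_Ico_succ_bot v.2, if_neg (lt_irrefl _), if_pos rfl, zero_add]
    refine Finset.sum_congr rfl fun w hw => ?_
    rw [Finset.mem_Ico] at hw
    rw [if_neg (by omega), if_neg (by omega)]

theorem steinhausGraph_mem_ESG {n : ℕ} {S : Fin (n - 1) → ZMod 2} :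
    steinhausGraph S ∈ ESG n ↔ ∀ v < n, vertexSum S v = 0 := by
  constructor
  · intro h v hv
    rw [← (isEvenGraph_iff _).1 h.2 ⟨v, hv⟩, sum_adjMat_steinhausGraph]
  · intro h
    refine ⟨steinhausGraph_mem_SG S, (isEvenGraph_iff _).2 fun v => ?_⟩
    rw [sum_adjMat_steinhausGraph, h v v.2]

theorem steinhausGraph_zero (n : ℕ) : steinhausGraph (0 : Fin (n - 1) → ZMod 2) = 0 := by
  have h : ∀ i j, triEntry (0 : Fin (n - 1) → ZMod 2) i j = 0 := by
    intro i
    induction i using Nat.strong_induction_on with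
    | _ i ih =>
      intro j
      rcases i with _ | _ | i
      · rfl
      · simp [triEntry, term]
      · rw [triEntry, ih _ (by omega), ih _ (by omega), add_zero]
  ext u v
  change _ ∧ _ ↔ False
  simp [h]

/-! ### A basis of the even Steinhaus graphs -/

/-- The adjacencies of the vertices numbered `l + 1` and `2l + 3`, `0 ≤ l < ⌊(n - 1) / 3⌋`. -/
noncomputable def coords (n : ℕ) : SimpleGraph (Fin n) →ₗ[ZMod 2] (Fin ((n - 1) / 3) → ZMod 2) where
  toFun G l := adjMat n G ⟨l, by omega⟩ ⟨2 * l + 2, by omega⟩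
  map_add' G H := by
    funext l
    simp
  map_smul' c G := by
    funext l
    simp

theorem coords_steinhausGraph {n : ℕ} (S : Fin (n - 1) → ZMod 2) (l : Fin ((n - 1) / 3)) :
    coords n (steinhausGraph S) l = triEntry S (l + 1) (2 * l + 2) :=
  adjMat_steinhausGraph S (by rw [Fin.mk_lt_mk]; omega)

theorem eq_zero_of_coords {n : ℕ} {G : SimpleGraph (Fin n)} (hG : G ∈ ESG n)
    (h : coords n G = 0) : G = 0 := by
  obtain ⟨S, rfl⟩ := exists_eq_steinhausGraph hG.1
  rw [eq_zero_of_vertexSum (steinhausGraph_mem_ESG.1 hG) fun l hl => ?_, steinhausGraph_zero]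
  rw [← coords_steinhausGraph S ⟨l, hl⟩, h, Pi.zero_apply]

/-- The graphs `ψ(T_k)`. -/
def psiFamily (n : ℕ) (k : Fin ((n - 1) / 3)) : SimpleGraph (Fin n) := psi n (basisTriangle n k)

theorem psiFamily_mem_ESG {n : ℕ} (k : Fin ((n - 1) / 3)) : psiFamily n k ∈ ESG n := by
  rw [psiFamily, psi_basisTriangle, steinhausGraph_mem_ESG]
  exact vertexSum_seqS n k (by omega)

theorem linearIndependent_coords (n : ℕ) :
    LinearIndependent (ZMod 2) (fun k => coords n (psiFamily n k)) := by
  refine Matrix.linearIndependent_rows_of_det_ne_zero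
    (A := Matrix.of fun k => coords n (psiFamily n k)) ?_
  have h : ∀ k l : Fin ((n - 1) / 3), k ≤ l →
      coords n (psiFamily n k) l = if k = l then 1 else 0 := by
    intro k l hkl
    rw [psiFamily, psi_basisTriangle, coords_steinhausGraph,
      triEntry_seqS_diag (by omega) (by exact hkl)]
    simp only [Fin.ext_iff]
  rw [Matrix.det_of_isLowerTriangular, Finset.prod_eq_one]
  · exact one_ne_zero
  · intro k _
    rw [Matrix.of_apply, h k k le_rfl, if_pos rfl]
  · intro k l hkl
    have hkl : k < l := hkl
    rw [Matrix.of_apply, h k l hkl.le, if_neg hkl.ne]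

theorem linearIndependent_psiFamily (n : ℕ) : LinearIndependent (ZMod 2) (psiFamily n) :=
  .of_comp (coords n) (linearIndependent_coords n)

/-- Independence and the count of coordinates let a combination of the family match the coordinates
of any even Steinhaus graph; `eq_zero_of_coords` then kills the difference. -/
theorem span_psiFamily (n : ℕ) : Submodule.span (ZMod 2) (Set.range (psiFamily n)) = ESG n := by
  refine le_antisymm (Submodule.span_le.2 ?_) fun G hG => ?_
  · rintro _ ⟨k, rfl⟩
    exact psiFamily_mem_ESG k
  · have htop := (linearIndependent_coords n).span_eq_top_of_card_eq_finrank' (by simp)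
    obtain ⟨c, hc⟩ := (Submodule.mem_span_range_iff_exists_fun (ZMod 2)).1
      (htop ▸ Submodule.mem_top : coords n G ∈ _)
    refine (Submodule.mem_span_range_iff_exists_fun (ZMod 2)).2 ⟨c, ?_⟩
    refine sub_eq_zero.1 (eq_zero_of_coords (sub_mem (sum_mem fun k _ =>
      Submodule.smul_mem _ _ (psiFamily_mem_ESG k)) hG) ?_)
    simp [hc]

/-! ### Odd Steinhaus graphs -/

/-- Handshake lemma: the number of vertices of odd degree is even. -/
theorem OSG_eq_empty {n : ℕ} (hn : Odd n) : OSG n = ∅ := by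
  classical
  refine Set.eq_empty_of_forall_notMem fun G hG => ?_
  have h := G.even_card_odd_degree_vertices
  have hG2 : ∀ v, Odd (G.degree v) := fun v => by convert hG.2 v
  simp only [hG2, Finset.filter_true, Finset.card_univ, Fintype.card_fin] at h
  exact (Nat.not_even_iff_odd.2 hn) h

/-- Only the last column is nonzero, so the graph is a star centred at vertex `n`, with degrees `1`
and `n - 1`, all odd when `n` is even. -/
theorem triEntry_seqLast (n : ℕ) (i j : ℕ) (hi : 1 ≤ i) (hij : i ≤ j) (hj : j ≤ n - 1) :
    triEntry (seqLast n) i j = if j = n - 1 then 1 else 0 := by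
  induction i, hi using Nat.le_induction generalizing j with
  | base => rw [triEntry, term, dif_pos ⟨hij, hj⟩, seqLast, Nat.sub_add_cancel hij]
  | succ i hi ih =>
    obtain ⟨i, rfl⟩ := Nat.exists_eq_add_of_le' hi
    rw [triEntry, ih _ (by omega) (by omega), ih _ (by omega) (by omega), if_neg (by omega),
      zero_add]

theorem vertexSum_seqLast {n : ℕ} (hn : Even n) (v : ℕ) (hv : v < n) :
    vertexSum (seqLast n) v = 1 := by
  rw [vertexSum, Finset.sum_congr rfl fun s hs =>
      triEntry_seqLast n (s + 1) v (by omega) (by rw [Finset.mem_range] at hs; omega) (by omega),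
    Finset.sum_congr rfl fun w hw =>
      triEntry_seqLast n (v + 1) w (by omega) (by rw [Finset.mem_Ico] at hw; omega)
        (by rw [Finset.mem_Ico] at hw; omega)]
  simp only [Finset.sum_const, Finset.card_range, Finset.sum_ite_eq', Finset.mem_Ico]
  split_ifs with h1 h2 h2
  · omega
  · have : Odd v := by rw [h1]; exact Nat.Even.sub_odd (by omega) hn odd_one
    rw [nsmul_one, add_zero, ZMod.natCast_eq_one_iff_odd.2 this]
  · simp
  · omega

theorem steinhausGraph_seqLast_mem_OSG {n : ℕ} (hn : Even n) :
    steinhausGraph (seqLast n) ∈ OSG n :=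
  ⟨steinhausGraph_mem_SG _, (isOddGraph_iff _).2 fun v => by
    rw [sum_adjMat_steinhausGraph, vertexSum_seqLast hn v v.2]⟩

theorem add_mem_ESG {n : ℕ} {G H : SimpleGraph (Fin n)} (hG : G ∈ OSG n) (hH : H ∈ OSG n) :
    G + H ∈ ESG n :=
  ⟨add_mem hG.1 hH.1, (isEvenGraph_iff _).2 fun v => by
    simp [Finset.sum_add_distrib, (isOddGraph_iff _).1 hG.2 v, (isOddGraph_iff _).1 hH.2 v,
      CharTwo.add_self_eq_zero]⟩

theorem add_mem_OSG {n : ℕ} {G H : SimpleGraph (Fin n)} (hG : G ∈ ESG n) (hH : H ∈ OSG n) :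
    G + H ∈ OSG n :=
  ⟨add_mem hG.1 hH.1, (isOddGraph_iff _).2 fun v => by
    simp [Finset.sum_add_distrib, (isEvenGraph_iff _).1 hG.2 v, (isOddGraph_iff _).1 hH.2 v]⟩

theorem OSG_eq {n : ℕ} (hn : Even n) :
    OSG n = {G | ∃ H ∈ ESG n, G = H + steinhausGraph (seqLast n)} := by
  have hL := steinhausGraph_seqLast_mem_OSG hn
  ext G
  constructor
  · intro hG
    refine ⟨G + steinhausGraph (seqLast n), add_mem_ESG hG hL, ?_⟩
    rw [add_assoc, ZModModule.add_self, add_zero]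
  · rintro ⟨H, hH, rfl⟩
    exact add_mem_OSG hH hL

theorem notMem_ESG_of_mem_OSG {n : ℕ} (hn : 1 ≤ n) {G : SimpleGraph (Fin n)} (hG : G ∈ OSG n) :
    G ∉ ESG n := fun h =>
  zero_ne_one (((isEvenGraph_iff _).1 h.2 ⟨0, hn⟩).symm.trans ((isOddGraph_iff _).1 hG.2 ⟨0, hn⟩))

/-- A linearly independent family with span `W` is a basis of `W`. -/
theorem exists_basis_of_span_eq {ι K V : Type*} [Ring K] [AddCommGroup V] [Module K V]
    {W : Submodule K V} {v : ι → V} (hv : LinearIndependent K v)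
    (hW : Submodule.span K (Set.range v) = W) :
    ∃ b : Module.Basis ι K W, ∀ i, (b i : V) = v i := by
  subst hW
  exact ⟨Module.Basis.span hv, fun i => congrArg Subtype.val (Module.Basis.span_apply hv i)⟩

theorem PRSG_eq_of_odd {n : ℕ} (hn : Odd n) : PRSG n = ESG n := by
  refine SetLike.coe_injective ?_
  change (ESG n : Set (SimpleGraph (Fin n))) ∪ OSG n = _
  rw [OSG_eq_empty hn, Set.union_empty]

theorem PRSG_eq_of_even {n : ℕ} (hn : Even n) :
    PRSG n = Submodule.span (ZMod 2) {steinhausGraph (seqLast n)} ⊔ ESG n := by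
  refine le_antisymm ?_ (sup_le ?_ fun G hG => Or.inl hG)
  · rintro G (hG | hG)
    · exact Submodule.mem_sup_right hG
    · rw [OSG_eq hn] at hG
      obtain ⟨H, hH, rfl⟩ := hG
      exact add_mem (Submodule.mem_sup_right hH)
        (Submodule.mem_sup_left (Submodule.mem_span_singleton_self _))
  · rw [Submodule.span_singleton_le_iff_mem]
    exact Or.inr (steinhausGraph_seqLast_mem_OSG hn)

end Steinhaus

theorem mainTheorem3 (n : ℕ) (hn : 1 ≤ n) :
    (∀ k : Fin ((n - 1) / 3),
      Steinhaus.basisTriangle n k ∈ Steinhaus.DSTz (2 * n - 1) ∧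
      Steinhaus.psi n (Steinhaus.basisTriangle n k) ∈ Steinhaus.ESG n ∧
      Steinhaus.psi n (Steinhaus.basisTriangle n k) =
        Steinhaus.steinhausGraph (Steinhaus.seqS n k)) ∧
    (Odd n →
      ∃ b : Module.Basis (Fin ((n - 1) / 3)) (ZMod 2) (Steinhaus.PRSG n),
        ∀ k, (b k : SimpleGraph (Fin n)) = Steinhaus.psi n (Steinhaus.basisTriangle n k)) ∧
    (Even n →
      Steinhaus.OSG n = {G | ∃ H ∈ Steinhaus.ESG n,
        G = H + Steinhaus.steinhausGraph (Steinhaus.seqLast n)} ∧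
      ∃ b : Module.Basis (Option (Fin ((n - 1) / 3))) (ZMod 2) (Steinhaus.PRSG n),
        (b none : SimpleGraph (Fin n)) = Steinhaus.steinhausGraph (Steinhaus.seqLast n) ∧
        ∀ k, (b (some k) : SimpleGraph (Fin n)) =
          Steinhaus.psi n (Steinhaus.basisTriangle n k)) := by
  open Steinhaus in
  refine ⟨fun k => ⟨basisTriangle_mem_DSTz n k hn, psiFamily_mem_ESG k, psi_basisTriangle n k⟩,
    fun hodd => ?_, fun heven => ⟨OSG_eq heven, ?_⟩⟩
  · exact exists_basis_of_span_eq (linearIndependent_psiFamily n)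
      ((span_psiFamily n).trans (PRSG_eq_of_odd hodd).symm)
  · obtain ⟨b, hb⟩ := exists_basis_of_span_eq (W := PRSG n)
      (v := fun o => Option.casesOn' o (steinhausGraph (seqLast n)) (psiFamily n))
      (linearIndependent_option'.2 ⟨linearIndependent_psiFamily n, by
        rw [span_psiFamily]
        exact notMem_ESG_of_mem_OSG hn (steinhausGraph_seqLast_mem_OSG heven)⟩) (by
        rw [PRSG_eq_of_even heven, ← span_psiFamily, ← Submodule.span_union]
        congr 1
        ext G
        simp [Option.exists, eq_comm])
    exact ⟨b, hb none, fun k => hb (some k)⟩
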